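/- Let $p>3$ be a prime and let $G$ be a group of order $p^5$ belonging to James's isoclinism family $\Phi_5$. Then $B_0(G)=0$. Here $B_0(G)=\bigcap_{A}\ker\bigl(\operatorname{res}^G_A\colon H^2(G,\mathbb{Q}/\mathbb{Z})\to H^2(A,\mathbb{Q}/\mathbb{Z})\bigr)$ is the Bogomolov multiplier of $G$, where $A$ runs over all abelian subgroups of $G$ and $\mathbb{Q}/\mathbb{Z}$ carries the trivial action. The family $\Phi_5$ (for the prime $p$) is the class of all groups isoclinic to the group $$\Phi_5(2111)=\langle \alpha_1,\alpha_2,\alpha_3,\alpha_4,\beta \mid [\alpha_1,\alpha_2]=[\alpha_3,\alpha_4]=\alpha_1^p=\beta,\ \alpha_2^p=\alpha_3^p=\alpha_4^p=\beta^p=1\rangle,$$ in which all pairs of generators other than $(\alpha_1,\alpha_2)$ and $(\alpha_3,\alpha_4)$ are understood to commute. Groups $G$ and $H$ are isoclinic if there are isomorphisms $\varphi\colon G/Z(G)\to H/Z(H)$ and $\psi\colon [G,G]\to[H,H]$ such that $\psi([x,y])=[u,v]$ whenever $x,y\in G$ and $u,v\in H$ satisfy $\varphi(xZ(G))=uZ(H)$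 and $\varphi(yZ(G))=vZ(H)$. -/

import Mathlib

universe u v

noncomputable section

/-- `ℚ/ℤ` as a trivial `G`-module. The lifts only adjust universes: an integer acts in the
usual way, so this is the trivial `ℤ[G]`-module `ℚ/ℤ`. -/
abbrev trivialQModZ (G : Type u) [Group G] : Rep.{u} (ULift.{u} ℤ) G :=
  Rep.trivial (ULift.{u} ℤ) G (ULift.{u} (AddCircle (1 : ℚ)))

/-- The restriction map `H²(G, ℚ/ℤ) → H²(A, ℚ/ℤ)` for a subgroup `A ≤ G`. -/
def resH2 (G : Type u) [Group G] (A : Subgroup G) :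
    groupCohomology (trivialQModZ G) 2 →ₗ[ULift.{u} ℤ]
      groupCohomology (Rep.res A.subtype (trivialQModZ G)) 2 :=
  (groupCohomology.map A.subtype
    (CategoryTheory.CategoryStruct.id (Rep.res A.subtype (trivialQModZ G))) 2).hom

/-- The Bogomolov multiplier `B₀(G)`: the intersection, over all abelian subgroups `A` of `G`, of
the kernels of the restriction maps `H²(G, ℚ/ℤ) → H²(A, ℚ/ℤ)`. -/
def bogomolovMultiplier (G : Type u) [Group G] :
    Submodule (ULift.{u} ℤ) (groupCohomology (trivialQModZ G) 2) :=
  ⨅ (A : Subgroup G) (_ : IsMulCommutative A), LinearMap.ker (resH2 G A)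

open scoped commutatorElement in
/-- Two groups are isoclinic (P. Hall) if there are isomorphisms `φ : G/Z(G) ≃ H/Z(H)` and
`ψ : [G,G] ≃ [H,H]` compatible with the commutator maps. (Whether one uses
`x y x⁻¹ y⁻¹` or `x⁻¹ y⁻¹ x y` as commutator does not matter: replace `x`, `y` by their
inverses.) -/
def Isoclinic (G : Type u) (H : Type v) [Group G] [Group H] : Prop :=
  ∃ (φ : (G ⧸ Subgroup.center G) ≃* (H ⧸ Subgroup.center H))
    (ψ : commutator G ≃* commutator H),
    ∀ (x y : G) (u v : H),
      φ (x : G ⧸ Subgroup.center G) = (u : H ⧸ Subgroup.center H) →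
      φ (y : G ⧸ Subgroup.center G) = (v : H ⧸ Subgroup.center H) →
      (ψ ⟨⁅x, y⁆, Subgroup.commutator_mem_commutator
        (Subgroup.mem_top x) (Subgroup.mem_top y)⟩ : H) = ⁅u, v⁆

/-- The commutator `[x, y] = x⁻¹ y⁻¹ x y`. -/
def rightCommutator {G : Type u} [Group G] (x y : G) : G := x⁻¹ * y⁻¹ * x * y

/-- The generators `α₁, α₂, α₃, α₄, β`. -/
inductive Phi5Gen : Type
  | a1 : Phi5Gen
  | a2 : Phi5Gen
  | a3 : Phi5Gen
  | a4 : Phi5Gen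
  | b : Phi5Gen

open FreeGroup Phi5Gen in
/-- The relators of `Φ₅(2111)`: `[α₁,α₂] = [α₃,α₄] = α₁^p = β`,
`α₂^p = α₃^p = α₄^p = β^p = 1`, and all other pairs of generators commute. -/
def phi5Relators (p : ℕ) : Set (FreeGroup Phi5Gen) :=
  {rightCommutator (of a1) (of a2) * (of b)⁻¹,
   rightCommutator (of a3) (of a4) * (of b)⁻¹,
   (of a1) ^ p * (of b)⁻¹,
   (of a2) ^ p,
   (of a3) ^ p,
   (of a4) ^ p,
   (of b) ^ p,
   rightCommutator (of a1) (of a3),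
   rightCommutator (of a1) (of a4),
   rightCommutator (of a2) (of a3),
   rightCommutator (of a2) (of a4),
   rightCommutator (of a1) (of b),
   rightCommutator (of a2) (of b),
   rightCommutator (of a3) (of b),
   rightCommutator (of a4) (of b)}

/-- The group `Φ₅(2111)` (for the prime `p`), given by its polycyclic presentation. -/
abbrev Phi5Group2111 (p : ℕ) : Type := PresentedGroup (phi5Relators p)

/-- `G` belongs to James's family `Φ₅`, the isoclinism class of the group `Φ₅(2111)`. -/
def InPhi5 (p : ℕ) (G : Type u) [Group G] : Prop := Isoclinic G (Phi5Group2111 p)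

end

/-! A cocycle with class in `B₀(G)` is symmetric on commuting pairs, so commuting pairs of `G` lift
to commuting pairs in the central extension `E` of `G` by `ℚ/ℤ`. Modulo its centre, `G` is generated
by two mutually commuting pairs with the same central commutator. Lifting one further commuting pair
shows that the lifted commutators still agree, so `[E,E]` is cyclic and meets the kernel trivially
(`HasSymplecticGenerators.eq_one_of_mem_commutator`). Hence `ℚ/ℤ` embeds in the abelianization of
`E`; divisibility gives a retraction, which splits `E` (`TrivialTwoCocycle.exists_eq_coboundary`).
The commutator structure passes from `Φ₅(2111)` to `G` by isoclinism. -/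

open scoped commutatorElement

/-! ### Commutator calculus in class two -/

section Commutators

variable {G : Type*} [Group G]

theorem commutator_le_of_closure_eq_top {S : Set G} (hS : Subgroup.closure S = ⊤)
    (N : Subgroup G) [N.Normal] (h : ∀ x ∈ S, ∀ y ∈ S, ⁅x, y⁆ ∈ N) : commutator G ≤ N := by
  have hcomm : ∀ x ∈ QuotientGroup.mk' N '' S, ∀ y ∈ QuotientGroup.mk' N '' S,
      x * y = y * x := by
    rintro _ ⟨x, hx, rfl⟩ _ ⟨y, hy, rfl⟩
    rw [← commutatorElement_eq_one_iff_mul_comm, ← map_commutatorElement]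
    exact (QuotientGroup.eq_one_iff _).2 (h x hx y hy)
  have := Subgroup.isMulCommutative_closure hcomm
  rw [← MonoidHom.map_closure, hS] at this
  rw [commutator_def, Subgroup.commutator_le]
  intro x _ y _
  rw [← QuotientGroup.eq_one_iff, ← QuotientGroup.mk'_apply, map_commutatorElement,
    commutatorElement_eq_one_iff_mul_comm]
  exact congrArg Subtype.val (this.is_comm.comm
    (⟨_, Subgroup.mem_map_of_mem _ (Subgroup.mem_top x)⟩ :
      Subgroup.map (QuotientGroup.mk' N) ⊤)
    ⟨_, Subgroup.mem_map_of_mem _ (Subgroup.mem_top y)⟩)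

theorem commutatorElement_zpow_left_of_mem_center {x y : G} (h : ⁅x, y⁆ ∈ Subgroup.center G)
    (k : ℤ) : ⁅x ^ k, y⁆ = ⁅x, y⁆ ^ k := by
  have hz : Commute ⁅x, y⁆ x := (Subgroup.mem_center_iff.1 h x).symm
  have e : y * x * y⁻¹ = ⁅x, y⁆⁻¹ * x := by rw [commutatorElement_def]; group
  have e' : y * (x ^ k)⁻¹ * y⁻¹ = ⁅x, y⁆ ^ k * x ^ (-k) := by
    rw [← zpow_neg, ← conj_zpow, e, hz.inv_left.mul_zpow, inv_zpow', neg_neg]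
  rw [commutatorElement_def, mul_assoc, mul_assoc, ← mul_assoc y, e', ← mul_assoc,
    (hz.zpow_zpow k k).symm.eq, mul_assoc, zpow_neg, mul_inv_cancel, mul_one]

theorem commutatorElement_mul_left_of_mem_center {x y z : G}
    (h : ⁅y, z⁆ ∈ Subgroup.center G) : ⁅x * y, z⁆ = ⁅x, z⁆ * ⁅y, z⁆ := by
  have hz := Subgroup.mem_center_iff.1 h
  calc ⁅x * y, z⁆ = x * ⁅y, z⁆ * (z * x⁻¹ * z⁻¹) := by simp only [commutatorElement_def]; group
    _ = ⁅x, z⁆ * ⁅y, z⁆ := by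
      rw [hz, mul_assoc, hz]; simp only [commutatorElement_def]; group

/-- This packs the comparison of two commutators into a single commutator, so that their equality
becomes the commuting of one pair, a property that lifts. -/
theorem commutatorElement_mul_mul_inv_of_commute (hc : ∀ x y : G, ⁅x, y⁆ ∈ Subgroup.center G)
    {x₁ x₂ x₃ x₄ : G} (h₁₄ : Commute x₁ x₄) (h₂₃ : Commute x₂ x₃) :
    ⁅x₁ * x₃, x₄⁻¹ * x₂⁆ = ⁅x₁, x₂⁆ * ⁅x₃, x₄⁆⁻¹ := by
  have mul_right : ∀ x, ⁅x, x₄⁻¹ * x₂⁆ = ⁅x, x₂⁆ * ⁅x, x₄⁻¹⁆ := fun x => by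
    rw [← commutatorElement_inv, commutatorElement_mul_left_of_mem_center (hc _ _),
      mul_inv_rev, commutatorElement_inv, commutatorElement_inv]
  have inv_right : ⁅x₃, x₄⁻¹⁆ = ⁅x₃, x₄⁆⁻¹ := by
    have := commutatorElement_zpow_left_of_mem_center (hc x₄ x₃) (-1)
    rw [zpow_neg_one, zpow_neg_one] at this
    rw [← commutatorElement_inv, this, commutatorElement_inv]
  rw [commutatorElement_mul_left_of_mem_center (hc _ _), mul_right, mul_right,
    h₁₄.inv_right.commutator_eq, h₂₃.symm.commutator_eq, mul_one, one_mul, inv_right]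

/-- The commutator structure of a central product of two groups of class two, each generated by
two elements modulo the centre, with common commutator `⁅a₁, a₂⁆ = ⁅a₃, a₄⁆`. -/
structure HasSymplecticGenerators (a₁ a₂ a₃ a₄ : G) : Prop where
  closure_eq_top : Subgroup.closure ({a₁, a₂, a₃, a₄} ∪ (Subgroup.center G : Set G)) = ⊤
  commutator_le_center : commutator G ≤ Subgroup.center G
  commutator_eq : ⁅a₁, a₂⁆ = ⁅a₃, a₄⁆
  comm₁₃ : Commute a₁ a₃
  comm₁₄ : Commute a₁ a₄
  comm₂₃ : Commute a₂ a₃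
  comm₂₄ : Commute a₂ a₄

theorem commutator_le_zpowers {a₁ a₂ a₃ a₄ : G}
    (hgen : Subgroup.closure ({a₁, a₂, a₃, a₄} ∪ (Subgroup.center G : Set G)) = ⊤)
    (hc : ⁅a₁, a₂⁆ ∈ Subgroup.center G) (heq : ⁅a₁, a₂⁆ = ⁅a₃, a₄⁆)
    (h₁₃ : Commute a₁ a₃) (h₁₄ : Commute a₁ a₄) (h₂₃ : Commute a₂ a₃) (h₂₄ : Commute a₂ a₄) :
    commutator G ≤ Subgroup.zpowers ⁅a₁, a₂⁆ := by
  have hle : Subgroup.zpowers ⁅a₁, a₂⁆ ≤ Subgroup.center G := by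
    rwa [Subgroup.zpowers_le]
  have : (Subgroup.zpowers ⁅a₁, a₂⁆).Normal := ⟨fun n hn g => by
    rw [Subgroup.mem_center_iff.1 (hle hn) g, mul_inv_cancel_right]; exact hn⟩
  set N := Subgroup.zpowers ⁅a₁, a₂⁆
  have h₁₂ : ⁅a₁, a₂⁆ ∈ N := Subgroup.mem_zpowers _
  have h₂₁ : ⁅a₂, a₁⁆ ∈ N := by rw [← commutatorElement_inv]; exact N.inv_mem h₁₂
  have h₃₄ : ⁅a₃, a₄⁆ ∈ N := heq ▸ h₁₂
  have h₄₃ : ⁅a₄, a₃⁆ ∈ N := by rw [← commutatorElement_inv]; exact N.inv_mem h₃₄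
  have key : ∀ {x y : G}, Commute x y → ⁅x, y⁆ ∈ N := fun h => by
    rw [h.commutator_eq]; exact N.one_mem
  refine commutator_le_of_closure_eq_top hgen N ?_
  rintro x (hx | hx) y hy
  swap
  · exact key (Subgroup.mem_center_iff.1 hx y).symm
  rcases hy with hy | hy
  swap
  · exact key (Subgroup.mem_center_iff.1 hy x)
  simp only [Set.mem_insert_iff, Set.mem_singleton_iff] at hx hy
  rcases hx with rfl | rfl | rfl | rfl <;> rcases hy with rfl | rfl | rfl | rfl <;>
    first
    | assumption
    | (apply key; first | exact Commute.refl _ | assumption | (apply Commute.symm; assumption))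

end Commutators

/-! ### Lifting commuting pairs through an extension -/

section Lifting

variable {E G : Type*} [Group E] [Group G]

/-- If commuting pairs lift to commuting pairs along a surjection `E → G`, and `G` has symplectic
generators, then the kernel meets the commutator subgroup of `E` trivially. -/
theorem HasSymplecticGenerators.eq_one_of_mem_commutator {a₁ a₂ a₃ a₄ : G}
    (h : HasSymplecticGenerators a₁ a₂ a₃ a₄) (π : E →* G) (hπ : Function.Surjective π)
    (hcomm : ∀ x y : E, Commute (π x) (π y) → Commute x y) {e : E} (he : e ∈ commutator E)
    (he1 : π e = 1) : e = 1 := by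
  obtain ⟨x₁, rfl⟩ := hπ a₁
  obtain ⟨x₂, rfl⟩ := hπ a₂
  obtain ⟨x₃, rfl⟩ := hπ a₃
  obtain ⟨x₄, rfl⟩ := hπ a₄
  have hcen : ∀ {x : E}, π x ∈ Subgroup.center G → x ∈ Subgroup.center E := fun {x} hx =>
    Subgroup.mem_center_iff.2 fun y => hcomm y x (Subgroup.mem_center_iff.1 hx (π y))
  have hcc : ∀ x y : E, ⁅x, y⁆ ∈ Subgroup.center E := fun x y => hcen <| by
    rw [map_commutatorElement]
    exact h.commutator_le_center
      (Subgroup.commutator_mem_commutator (Subgroup.mem_top _) (Subgroup.mem_top _))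
  have h₁₃ := hcomm _ _ h.comm₁₃
  have h₁₄ := hcomm _ _ h.comm₁₄
  have h₂₃ := hcomm _ _ h.comm₂₃
  have h₂₄ := hcomm _ _ h.comm₂₄
  have hGc : ∀ x y : G, ⁅x, y⁆ ∈ Subgroup.center G := fun x y => h.commutator_le_center
    (Subgroup.commutator_mem_commutator (Subgroup.mem_top _) (Subgroup.mem_top _))
  -- The decisive commuting pair: below, its commutator is `⁅a₁, a₂⁆ * ⁅a₃, a₄⁆⁻¹ = 1`.
  have hpair : Commute (x₁ * x₃) (x₄⁻¹ * x₂) := by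
    apply hcomm
    rw [map_mul, map_mul, map_inv, ← commutatorElement_eq_one_iff_commute,
      commutatorElement_mul_mul_inv_of_commute hGc h.comm₁₄ h.comm₂₃, h.commutator_eq, mul_inv_cancel]
  have heq : ⁅x₁, x₂⁆ = ⁅x₃, x₄⁆ := by
    rw [← commutatorElement_eq_one_iff_commute,
      commutatorElement_mul_mul_inv_of_commute hcc h₁₄ h₂₃] at hpair
    exact mul_inv_eq_one.1 hpair
  have hgen : Subgroup.closure ({x₁, x₂, x₃, x₄} ∪ (Subgroup.center E : Set E)) = ⊤ := by
    set S := Subgroup.closure ({x₁, x₂, x₃, x₄} ∪ (Subgroup.center E : Set E))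
    have hcS : Subgroup.center E ≤ S := fun z hz => Subgroup.subset_closure (Or.inr hz)
    have hker : π.ker ≤ S := fun z hz => hcS <| hcen <| by
      rw [MonoidHom.mem_ker.1 hz]; exact Subgroup.one_mem _
    have hmap : S.map π = ⊤ := by
      rw [eq_top_iff, ← h.closure_eq_top, Subgroup.closure_le]
      rintro y (hy | hy)
      · simp only [Set.mem_insert_iff, Set.mem_singleton_iff] at hy
        rcases hy with rfl | rfl | rfl | rfl <;>
          exact Subgroup.mem_map_of_mem _ (Subgroup.subset_closure (Or.inl (by simp)))
      · obtain ⟨x, rfl⟩ := hπ y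
        exact Subgroup.mem_map_of_mem _ (hcS (hcen hy))
    rw [← Subgroup.comap_map_eq_self hker, hmap, Subgroup.comap_top]
  obtain ⟨k, rfl⟩ := Subgroup.mem_zpowers_iff.1 <|
    commutator_le_zpowers hgen (hcc _ _) heq h₁₃ h₁₄ h₂₃ h₂₄ he
  -- A power of the generating commutator is itself one commutator `⁅x₁ ^ k, x₂⁆`, so its vanishing
  -- in `G` lifts to `E`.
  rw [← commutatorElement_zpow_left_of_mem_center (hcc _ _)] at he1 ⊢
  rw [commutatorElement_eq_one_iff_commute]
  apply hcomm
  rwa [map_commutatorElement, commutatorElement_eq_one_iff_commute] at he1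

end Lifting

/-! ### Central extensions and the splitting criterion -/

section CocycleExtension

/-- A 2-cocycle of `G` with values in the trivial module `T`. -/
structure TrivialTwoCocycle (G T : Type*) [Group G] [AddCommGroup T] where
  toFun : G → G → T
  cocycle : ∀ g h j, toFun (g * h) j + toFun g h = toFun h j + toFun g (h * j)

namespace TrivialTwoCocycle

variable {G T : Type*} [Group G] [AddCommGroup T] (c : TrivialTwoCocycle G T)

theorem map_one_left (g : G) : c.toFun 1 g = c.toFun 1 1 := by
  have := c.cocycle 1 1 g
  simp only [one_mul] at this
  exact (add_left_cancel this).symm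

theorem map_one_right (g : G) : c.toFun g 1 = c.toFun 1 1 := by
  have := c.cocycle g 1 1
  simp only [mul_one] at this
  exact add_right_cancel this

/-- The central extension of `G` by `T` attached to a 2-cocycle. -/
@[ext]
structure Extension (c : TrivialTwoCocycle G T) where
  base : G
  fiber : T

namespace Extension

instance : Mul c.Extension :=
  ⟨fun x y => ⟨x.base * y.base, x.fiber + y.fiber + c.toFun x.base y.base⟩⟩

/-- The cocycle is not assumed normalized, hence the correction by `c.toFun 1 1`, here and in
`incl`. -/
instance : One c.Extension := ⟨⟨1, -c.toFun 1 1⟩⟩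

instance : Inv c.Extension :=
  ⟨fun x => ⟨x.base⁻¹, -x.fiber - c.toFun x.base⁻¹ x.base - c.toFun 1 1⟩⟩

variable {c}

@[simp] theorem base_mul (x y : c.Extension) : (x * y).base = x.base * y.base := rfl

@[simp] theorem fiber_mul (x y : c.Extension) :
    (x * y).fiber = x.fiber + y.fiber + c.toFun x.base y.base := rfl

@[simp] theorem base_one : (1 : c.Extension).base = 1 := rfl

@[simp] theorem fiber_one : (1 : c.Extension).fiber = -c.toFun 1 1 := rfl

@[simp] theorem base_inv (x : c.Extension) : x⁻¹.base = x.base⁻¹ := rfl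

@[simp] theorem fiber_inv (x : c.Extension) :
    x⁻¹.fiber = -x.fiber - c.toFun x.base⁻¹ x.base - c.toFun 1 1 := rfl

variable (c) in
instance : Group c.Extension :=
  Group.ofLeftAxioms
    (fun x y z => by
      ext
      · simp [mul_assoc]
      · have := c.cocycle x.base y.base z.base
        simp only [fiber_mul, base_mul]
        rw [← sub_eq_zero] at this ⊢
        rw [← this]
        abel)
    (fun x => by ext <;> simp [map_one_left])
    (fun x => by
      ext
      · simp
      · simp only [fiber_mul, base_inv, fiber_inv, fiber_one]; abel)

variable (c)

/-- The projection of the extension onto `G`. -/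
def proj : c.Extension →* G where
  toFun := base
  map_one' := rfl
  map_mul' _ _ := rfl

/-- The inclusion of the kernel `T` into the extension. -/
def incl : Multiplicative T →* c.Extension where
  toFun t := ⟨1, t.toAdd - c.toFun 1 1⟩
  map_one' := by ext <;> simp
  map_mul' s t := by
    ext
    · simp
    · simp only [fiber_mul, toAdd_mul]; abel

theorem proj_surjective : Function.Surjective (proj c) := fun g => ⟨⟨g, 0⟩, rfl⟩

theorem incl_injective : Function.Injective (incl c) := fun s t h => by
  have := congrArg fiber h
  exact Multiplicative.toAdd.injective (sub_left_injective this)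

theorem proj_incl (t : Multiplicative T) : proj c (incl c t) = 1 := rfl

end Extension

open Extension in
/-- A cocycle with values in a divisible group is a coboundary as soon as the commutator subgroup
of its extension meets the kernel trivially. -/
theorem exists_eq_coboundary [DivisibleBy T ℤ]
    (h : ∀ e ∈ commutator c.Extension, proj c e = 1 → e = 1) :
    ∃ f : G → T, ∀ g k, c.toFun g k = f g + f k - f (g * k) := by
  let i : T →+ Additive (Abelianization c.Extension) :=
    MonoidHom.toAdditiveRight (Abelianization.of.comp (incl c))
  have hi : Function.Injective i := by
    rw [injective_iff_map_eq_zero]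
    intro t ht
    have ht' : Abelianization.of (incl c (Multiplicative.ofAdd t)) = 1 := ht
    have hmem : incl c (Multiplicative.ofAdd t) ∈ commutator c.Extension :=
      (QuotientGroup.eq_one_iff _).1 ht'
    have := h _ hmem (proj_incl c _)
    exact (map_eq_one_iff _ (incl_injective c)).1 this
  -- Divisible groups are injective, so the identity of `T` extends along `i`.
  obtain ⟨r, hr⟩ := (Module.Baer.of_divisible T).extension_property i.toIntLinearMap hi
    LinearMap.id
  let ρ : c.Extension → T := fun e => r (Additive.ofMul (Abelianization.of e))
  have hmul : ∀ x y, ρ (x * y) = ρ x + ρ y := fun x y => by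
    simp only [ρ, map_mul, ofMul_mul, map_add]
  have hincl : ∀ t : T, ρ (incl c (Multiplicative.ofAdd t)) = t := fun t =>
    LinearMap.congr_fun hr t
  refine ⟨fun g => ρ ⟨g, 0⟩, fun g k => ?_⟩
  -- The cocycle measures the failure of the section `g ↦ ⟨g, 0⟩` to be multiplicative; `ρ` turns
  -- this into the coboundary equation.
  have e : (⟨g, 0⟩ * ⟨k, 0⟩ : c.Extension) =
      incl c (Multiplicative.ofAdd (c.toFun g k)) * ⟨g * k, 0⟩ := by
    ext
    · simp [incl]
    · simp [incl, map_one_left]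
  have := congrArg ρ e
  rw [hmul, hmul, hincl] at this
  rw [this, add_sub_cancel_right]

open Extension in
theorem exists_eq_coboundary_of_symm [DivisibleBy T ℤ] {a₁ a₂ a₃ a₄ : G}
    (ha : HasSymplecticGenerators a₁ a₂ a₃ a₄)
    (hc : ∀ g k, Commute g k → c.toFun g k = c.toFun k g) :
    ∃ f : G → T, ∀ g k, c.toFun g k = f g + f k - f (g * k) := by
  refine c.exists_eq_coboundary fun e he he1 =>
    ha.eq_one_of_mem_commutator (proj c) (proj_surjective c) (fun x y hxy => ?_) he he1
  ext
  · exact hxy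
  · simp only [fiber_mul, hc x.base y.base hxy, add_comm x.fiber]

end TrivialTwoCocycle

end CocycleExtension

/-! ### Isoclinism and the presented group -/

section Isoclinism

/-- `Isoclinic` transports the commutator structure of symplectic generators. -/
theorem Isoclinic.exists_hasSymplecticGenerators {G : Type*} {H : Type*} [Group G] [Group H]
    (hGH : Isoclinic G H) {b₁ b₂ b₃ b₄ : H} (hb : HasSymplecticGenerators b₁ b₂ b₃ b₄) :
    ∃ a₁ a₂ a₃ a₄ : G, HasSymplecticGenerators a₁ a₂ a₃ a₄ := by
  obtain ⟨φ, ψ, hφψ⟩ := hGH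
  have lift : ∀ b : H, ∃ a : G, φ (a : G ⧸ Subgroup.center G) = (b : H ⧸ Subgroup.center H) :=
    fun b => by
      obtain ⟨a, ha⟩ := QuotientGroup.mk_surjective (φ.symm (b : H ⧸ Subgroup.center H))
      exact ⟨a, by rw [ha, φ.apply_symm_apply]⟩
  have hcomm : ∀ {x y : G} {u v : H},
      φ (x : G ⧸ Subgroup.center G) = (u : H ⧸ Subgroup.center H) →
      φ (y : G ⧸ Subgroup.center G) = (v : H ⧸ Subgroup.center H) →
      Commute u v → Commute x y := fun {x y u v} hx hy huv => by
    have := hφψ x y u v hx hy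
    rw [huv.commutator_eq, OneMemClass.coe_eq_one, map_eq_one_iff _ ψ.injective,
      ← OneMemClass.coe_eq_one] at this
    exact commutatorElement_eq_one_iff_commute.1 this
  obtain ⟨a₁, h₁⟩ := lift b₁
  obtain ⟨a₂, h₂⟩ := lift b₂
  obtain ⟨a₃, h₃⟩ := lift b₃
  obtain ⟨a₄, h₄⟩ := lift b₄
  refine ⟨a₁, a₂, a₃, a₄, ?_, ?_, ?_, hcomm h₁ h₃ hb.comm₁₃, hcomm h₁ h₄ hb.comm₁₄,
    hcomm h₂ h₃ hb.comm₂₃, hcomm h₂ h₄ hb.comm₂₄⟩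
  · set S := Subgroup.closure ({a₁, a₂, a₃, a₄} ∪ (Subgroup.center G : Set G))
    have hcS : Subgroup.center G ≤ S := fun z hz => Subgroup.subset_closure (Or.inr hz)
    -- Generation is tested in `H`, by pulling back the image of `S` in `H ⧸ Z(H)`; this suffices
    -- because `S` contains the centre of `G`.
    have hle : ∀ b : H, b ∈ Subgroup.comap (QuotientGroup.mk' (Subgroup.center H))
        ((S.map (QuotientGroup.mk' (Subgroup.center G))).map φ.toMonoidHom) := by
      rw [← Subgroup.eq_top_iff', eq_top_iff, ← hb.closure_eq_top, Subgroup.closure_le]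
      have hm : ∀ {a : G} {b : H}, a ∈ S →
          φ (a : G ⧸ Subgroup.center G) = (b : H ⧸ Subgroup.center H) →
          b ∈ Subgroup.comap (QuotientGroup.mk' (Subgroup.center H))
            ((S.map (QuotientGroup.mk' (Subgroup.center G))).map φ.toMonoidHom) := fun ha hab =>
        ⟨_, Subgroup.mem_map_of_mem _ ha, hab⟩
      have hs : ({a₁, a₂, a₃, a₄} : Set G) ⊆ S := fun x hx => Subgroup.subset_closure (Or.inl hx)
      rintro b (hb | hb)
      · simp only [Set.mem_insert_iff, Set.mem_singleton_iff] at hb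
        rcases hb with rfl | rfl | rfl | rfl
        exacts [hm (hs (by simp)) h₁, hm (hs (by simp)) h₂, hm (hs (by simp)) h₃,
          hm (hs (by simp)) h₄]
      · refine hm S.one_mem ?_
        rw [QuotientGroup.mk_one, map_one, eq_comm, QuotientGroup.eq_one_iff]
        exact hb
    rw [eq_top_iff]
    intro g _
    obtain ⟨b, hb'⟩ := QuotientGroup.mk_surjective (φ (g : G ⧸ Subgroup.center G))
    obtain ⟨_, ⟨s, hs, rfl⟩, hsb⟩ := hle b
    have hsg : (s : G ⧸ Subgroup.center G) = g := φ.injective (hsb.trans hb')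
    have := S.mul_mem hs (hcS (QuotientGroup.eq.1 hsg))
    rwa [mul_inv_cancel_left] at this
  · rw [commutator_def, Subgroup.commutator_le]
    intro x _ y _
    obtain ⟨u, hu⟩ := QuotientGroup.mk_surjective (φ (x : G ⧸ Subgroup.center G))
    obtain ⟨v, hv⟩ := QuotientGroup.mk_surjective (φ (y : G ⧸ Subgroup.center G))
    rw [← QuotientGroup.eq_one_iff, ← map_eq_one_iff _ φ.injective, ← QuotientGroup.mk'_apply,
      map_commutatorElement, map_commutatorElement]
    simp only [QuotientGroup.mk'_apply]
    rw [← hu, ← hv]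
    have := hb.commutator_le_center
      (Subgroup.commutator_mem_commutator (Subgroup.mem_top u) (Subgroup.mem_top v))
    exact (QuotientGroup.eq_one_iff _).2 this
  · have h := (hφψ a₁ a₂ b₁ b₂ h₁ h₂).trans
      (hb.commutator_eq.trans (hφψ a₃ a₄ b₃ b₄ h₃ h₄).symm)
    exact congrArg Subtype.val (ψ.injective (Subtype.ext h))

theorem commute_of_rightCommutator_eq_one {G : Type*} [Group G] {x y : G}
    (h : rightCommutator x y = 1) : Commute x y := by
  have : x * y = y * x * rightCommutator x y := by rw [rightCommutator]; group
  rwa [h, mul_one] at this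

theorem commutatorElement_eq_of_rightCommutator_eq {G : Type*} [Group G] {x y z : G}
    (h : rightCommutator x y = z) (hz : z ∈ Subgroup.center G) : ⁅x, y⁆ = z := by
  have : x * y = y * x * rightCommutator x y := by rw [rightCommutator]; group
  rw [commutatorElement_def, this, h, Subgroup.mem_center_iff.1 hz]
  group

open Phi5Gen in
theorem Phi5Group2111.hasSymplecticGenerators (p : ℕ) :
    HasSymplecticGenerators (PresentedGroup.of a1 : Phi5Group2111 p) (PresentedGroup.of a2)
      (PresentedGroup.of a3) (PresentedGroup.of a4) := by
  let q : Phi5Gen → Phi5Group2111 p := PresentedGroup.of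
  have rel : ∀ r ∈ phi5Relators p, PresentedGroup.mk (phi5Relators p) r = 1 :=
    fun r hr => PresentedGroup.one_of_mem hr
  have comm : ∀ x y, rightCommutator (FreeGroup.of x) (FreeGroup.of y) ∈ phi5Relators p →
      Commute (q x) (q y) := fun x y h =>
    commute_of_rightCommutator_eq_one (rel _ h)
  have val : ∀ x y, rightCommutator (FreeGroup.of x) (FreeGroup.of y) * (FreeGroup.of b)⁻¹ ∈
      phi5Relators p → rightCommutator (q x) (q y) = q b := fun x y h =>
    mul_inv_eq_one.1 (rel _ h)
  have htop : Subgroup.closure (Set.range q) = ⊤ := PresentedGroup.closure_range_of _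
  have hb : q b ∈ Subgroup.center (Phi5Group2111 p) := by
    have : Subgroup.closure (Set.range q) ≤ Subgroup.centralizer {q b} := by
      rw [Subgroup.closure_le]
      rintro _ ⟨x, rfl⟩
      rw [SetLike.mem_coe, Subgroup.mem_centralizer_singleton_iff]
      cases x
      case b => rfl
      all_goals exact (comm _ _ (by simp [phi5Relators])).eq
    rw [htop] at this
    exact Subgroup.mem_center_iff.2 fun g =>
      Subgroup.mem_centralizer_singleton_iff.1 (this (Subgroup.mem_top g))
  have h₁₂ : ⁅q a1, q a2⁆ = q b :=
    commutatorElement_eq_of_rightCommutator_eq (val _ _ (by simp [phi5Relators])) hb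
  have h₃₄ : ⁅q a3, q a4⁆ = q b :=
    commutatorElement_eq_of_rightCommutator_eq (val _ _ (by simp [phi5Relators])) hb
  have h₁₃ := comm a1 a3 (by simp [phi5Relators])
  have h₁₄ := comm a1 a4 (by simp [phi5Relators])
  have h₂₃ := comm a2 a3 (by simp [phi5Relators])
  have h₂₄ := comm a2 a4 (by simp [phi5Relators])
  have hgen : Subgroup.closure ({q a1, q a2, q a3, q a4} ∪
      (Subgroup.center (Phi5Group2111 p) : Set (Phi5Group2111 p))) = ⊤ := by
    rw [eq_top_iff, ← htop, Subgroup.closure_le]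
    rintro _ ⟨x, rfl⟩
    apply Subgroup.subset_closure
    cases x
    case b => exact Or.inr hb
    all_goals exact Or.inl (by simp)
  refine ⟨hgen, ?_, h₁₂.trans h₃₄.symm, h₁₃, h₁₄, h₂₃, h₂₄⟩
  refine (commutator_le_zpowers hgen (h₁₂ ▸ hb) (h₁₂.trans h₃₄.symm) h₁₃ h₁₄ h₂₃ h₂₄).trans ?_
  rw [Subgroup.zpowers_le, h₁₂]
  exact hb

end Isoclinism

/-! ### From cohomology classes to cocycles -/

section BogomolovMultiplier

universe w

variable {G : Type w} [Group G]

/-- A cocycle whose class restricts to zero on an abelian subgroup is symmetric there. -/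
theorem cocycle_symm_of_resH2_eq_zero (A : Subgroup G) [IsMulCommutative A]
    (c : groupCohomology.cocycles₂ (trivialQModZ G))
    (h : resH2 G A (groupCohomology.H2π _ c) = 0) (x y : A) :
    c ((x : G), (y : G)) = c ((y : G), (x : G)) := by
  have h' : groupCohomology.H2π _ (groupCohomology.mapCocycles₂ A.subtype
      (CategoryTheory.CategoryStruct.id (Rep.res A.subtype (trivialQModZ G))) c) = 0 := by
    rw [← h]
    exact (groupCohomology.H2π_comp_map_apply A.subtype _ c).symm
  obtain ⟨f, hf⟩ := (groupCohomology.H2π_eq_zero_iff _).1 h'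
  have hxy : f y - f (x * y) + f x = c ((x : G), (y : G)) := congrFun hf (x, y)
  have hyx : f x - f (y * x) + f y = c ((y : G), (x : G)) := congrFun hf (y, x)
  rw [← hxy, ← hyx, mul_comm' x y]
  abel

theorem cocycle_symm_of_mem_bogomolovMultiplier
    (c : groupCohomology.cocycles₂ (trivialQModZ G))
    (h : groupCohomology.H2π _ c ∈ bogomolovMultiplier G) {x y : G} (hxy : Commute x y) :
    c (x, y) = c (y, x) := by
  -- A commuting pair generates an abelian subgroup, one of those in the definition of `B₀(G)`.
  have hA : IsMulCommutative (Subgroup.closure {x, y}) := by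
    apply Subgroup.isMulCommutative_closure
    rintro u (rfl | rfl) v (rfl | rfl)
    exacts [rfl, hxy, hxy.symm, rfl]
  simp only [bogomolovMultiplier, Submodule.mem_iInf, LinearMap.mem_ker] at h
  exact cocycle_symm_of_resH2_eq_zero _ c (h _ hA)
    ⟨x, Subgroup.subset_closure (by simp)⟩ ⟨y, Subgroup.subset_closure (by simp)⟩

theorem HasSymplecticGenerators.bogomolovMultiplier_eq_bot {a₁ a₂ a₃ a₄ : G}
    (ha : HasSymplecticGenerators a₁ a₂ a₃ a₄) : bogomolovMultiplier G = ⊥ := by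
  rw [eq_bot_iff]
  intro x hx
  induction x using groupCohomology.H2_induction_on with | h c =>
  let d : TrivialTwoCocycle G (AddCircle (1 : ℚ)) :=
    { toFun := fun g k => (c (g, k)).down
      cocycle := fun g h j =>
        congrArg ULift.down ((groupCohomology.mem_cocycles₂_iff c).1 c.2 g h j) }
  obtain ⟨f, hf⟩ := d.exists_eq_coboundary_of_symm ha fun g k hgk =>
    congrArg ULift.down (cocycle_symm_of_mem_bogomolovMultiplier c hx hgk)
  rw [Submodule.mem_bot, groupCohomology.H2π_eq_zero_iff]
  refine ⟨fun g => ULift.up (f g), funext fun ⟨g, k⟩ => ULift.down_injective ?_⟩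
  change f k - f (g * k) + f g = (c (g, k)).down
  rw [show (c (g, k)).down = _ from hf g k]
  abel

end BogomolovMultiplier

theorem proposition3p4 (p : ℕ) (hp : p.Prime) (hp3 : 3 < p) (G : Type*) [Group G]
    (hG : Nat.card G = p ^ 5) (hPhi : InPhi5 p G) :
    bogomolovMultiplier G = ⊥ := by
  obtain ⟨_, _, _, _, ha⟩ :=
    hPhi.exists_hasSymplecticGenerators (Phi5Group2111.hasSymplecticGenerators p)
  exact ha.bogomolovMultiplier_eq_bot
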